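/- **Theorem 1 (k-trip cumulative lower bound).** A *scene* is a set $S$ of axis-parallel rectangular obstacles in the plane with pairwise disjoint interiors (they may touch), each of width and height at least $1$ and with integral $x$-coordinates of its corners, such that the start point $s=(0,0)$ is in the interior of none of them. The target is the wall, i.e. the line $x=n$. A point robot may be anywhere outside the interiors of the obstacles (so it can squeeze between touching obstacles). It does not know the scene; it discovers an obstacle only when it touches it (it may then be told the whole obstacle). A *deterministic algorithm* $R$ for $k$ trips prescribes, in every scene $S$, a continuous motion of the robot that starts at $s$ and makes $k$ trips, going alternately from $s$ to the wall and from the wall back to $s$; the motion up to any moment depends on $S$ only through the obstacles touched so far, i.e. if the motion in $S$ up to some moment would touch exactly the same obstacles at the same moments in $S'$, then the motion in $S'$ up to that moment is the same. Let $R_i(S)$ be the distance traveled in the $i$-th trip, let $L(S)$ be the (infimal) length of an obstacle-free path from $s$ to the wall, and let $$\rho(R,n,k)=\sup_{S}\frac{\sum_{i=1}^{k}R_i(S)}{k\,L(S)}\in[0,\infty].$$ Then for every real $n$, every integer $k$ with $1\le k\le n$, and every deterministic algorithm $R$ for $k$ trips, $$\rho(R,n,k)\ \ge\ \frac1{12}\sqrt{\frac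 nk}.$$ -/

import Mathlib

open Set

namespace Navigation

/-- The plane, with its Euclidean distance. -/
abbrev Plane := EuclideanSpace ℝ (Fin 2)

/-- An obstacle: an axis-parallel rectangle `[left, right] × [bottom, top]` of width and height at
least 1, the `x`-coordinates of whose corners are integers. -/
structure Obstacle where
  left : ℤ
  right : ℤ
  bottom : ℝ
  top : ℝ
  one_le_width : left + 1 ≤ right
  one_le_height : bottom + 1 ≤ top

/-- The closed rectangle occupied by an obstacle. -/
def Obstacle.body (O : Obstacle) : Set Plane :=
  {p | (O.left : ℝ) ≤ p 0 ∧ p 0 ≤ O.right ∧ O.bottom ≤ p 1 ∧ p 1 ≤ O.top}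

/-- The open rectangle that the robot cannot enter. -/
def Obstacle.inner (O : Obstacle) : Set Plane :=
  {p | (O.left : ℝ) < p 0 ∧ p 0 < O.right ∧ O.bottom < p 1 ∧ p 1 < O.top}

/-- The start point `s`, the origin. -/
def start : Plane := 0

/-- The target `t`: the infinite vertical line `x = n`. -/
def wall (n : ℝ) : Set Plane := {p | p 0 = n}

/-- A scene: a set of non-overlapping obstacles (they may touch), none of which contains the start
point in its interior. -/
structure Scene where
  obstacles : Set Obstacle
  nonoverlapping : obstacles.Pairwise fun O O' => Disjoint O.inner O'.inner
  start_free : ∀ O ∈ obstacles, start ∉ O.inner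

/-- The points where a point robot may be. It can walk along the sides of obstacles, and squeeze
between obstacles that touch. -/
def Scene.free (S : Scene) : Set Plane := {p | ∀ O ∈ S.obstacles, p ∉ O.inner}

/-- The obstacles that a robot located at `p` touches. -/
def Scene.touched (S : Scene) (p : Plane) : Set Obstacle := {O ∈ S.obstacles | p ∈ O.body}

/-- `γ`, on the time interval `[0, 1]`, is an obstacle-free path from the start point to the
wall. -/
structure Scene.IsPathToWall (S : Scene) (n : ℝ) (γ : ℝ → Plane) : Prop where
  continuousOn : ContinuousOn γ (Icc 0 1)
  source : γ 0 = start
  target : γ 1 ∈ wall n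
  free : ∀ t ∈ Icc (0 : ℝ) 1, γ t ∈ S.free

/-- `L(S)`: the length of the shortest obstacle-free path from the start point to the wall. -/
noncomputable def Scene.shortest (S : Scene) (n : ℝ) : ENNReal :=
  ⨅ (γ : ℝ → Plane) (_ : S.IsPathToWall n γ), eVariationOn γ (Icc 0 1)

/-- Where the robot is to be when its first `i` trips are over: it goes back and forth between the
start point and the wall. -/
def goal (n : ℝ) (i : ℕ) : Set Plane := if Even i then {start} else wall n

/-- A deterministic on-line strategy for making `k` trips between the start point and the wall
`x = n`, using tactile sensing only.

`path S` is the motion of the robot in the scene `S`. Time is merely a parameter of the motion: the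
speed is unrestricted and the robot may rest, and the clock is normalised so that the `i`-th trip
takes place during `[i - 1, i]`.

The last field says that the strategy is deterministic and depends on the scene only through what
has been touched so far: if the motion in `S` up to time `T` would have touched exactly the same
obstacles at the same times in the scene `S'`, then the robot is at the same place at time `T` in
`S'`. An obstacle is disclosed entirely as soon as it is touched, so that strategies that are only
told the position of its nearest corner are included. -/
structure Strategy (n : ℝ) (k : ℕ) where
  path : Scene → ℝ → Plane
  continuousOn : ∀ S, ContinuousOn (path S) (Icc 0 k)
  free : ∀ S, ∀ t ∈ Icc (0 : ℝ) k, path S t ∈ S.free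
  goal_mem : ∀ S, ∀ i : ℕ, i ≤ k → path S i ∈ goal n i
  online : ∀ S S' : Scene, ∀ T ∈ Icc (0 : ℝ) k,
    (∀ t ∈ Icc 0 T, S.touched (path S t) = S'.touched (path S t)) → path S' T = path S T

namespace Strategy

variable {n : ℝ} {k : ℕ}

/-- `R_i(S)`: the distance traveled by the robot in the `i`-th trip, `1 ≤ i ≤ k`. -/
noncomputable def tripDist (R : Strategy n k) (S : Scene) (i : ℕ) : ENNReal :=
  eVariationOn (R.path S) (Icc ((i : ℝ) - 1) i)

/-- `R^{(k)}(S)`: the total distance traveled by the robot in the `k` trips. -/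
noncomputable def totalDist (R : Strategy n k) (S : Scene) : ENNReal :=
  ∑ i ∈ Finset.Icc 1 k, R.tripDist S i

/-- `ρ(R, n, k)`: the cumulative `k`-trip competitive ratio, the supremum over all scenes `S` of
`R^{(k)}(S) / (k L(S))`. -/
noncomputable def cumulativeRatio (R : Strategy n k) : ENNReal :=
  ⨆ S : Scene, R.totalDist S / (k * S.shortest n)

end Strategy

end Navigation

/-!
The adversary fills the plane with a brick wall whose bricks have width `1` and height `h`, odd
columns being shifted down by half a brick. Inside a column one can only walk between two bricks, so
passing from one column to the next costs `h / 2`, and each trip costs at least about `n * h / 2`.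

While the robot moves by less than `h / 2`, it cannot meet two adjacent open columns, so it touches
bricks of at most three columns and two rows. A motion of total length `V` therefore touches only
`O(V / h)` bricks. Removing all other bricks does not change the motion, and among the `2 * J`
horizontal lines closest to the start point, each in its own row of bricks, one meets only
`O(V / (h * J))` of the bricks that remain. Each of them can be bypassed at the cost of `h / 2`.

With `h = n` and `J ≈ √(3 * V / n)` this proves the bound when `36 * k ≤ n`; otherwise it is at most
`1`, and the ratio is at least `1` in the scene without obstacles.
-/

namespace Navigation

section Variation

variable {α E : Type*} [LinearOrder α]

lemma eVariationOn_uIcc_add_uIcc [PseudoEMetricSpace E] (f : α → E) {a b c : α}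
    (hb : b ∈ uIcc a c) :
    eVariationOn f (uIcc a b) + eVariationOn f (uIcc b c) = eVariationOn f (uIcc a c) := by
  rcases le_total a c with hac | hca
  · rw [uIcc_of_le hac] at hb ⊢
    rw [uIcc_of_le hb.1, uIcc_of_le hb.2]
    simpa only [univ_inter] using eVariationOn.Icc_add_Icc f hb.1 hb.2 (mem_univ b)
  · rw [uIcc_of_ge hca] at hb ⊢
    rw [uIcc_of_ge hb.1, uIcc_of_ge hb.2, add_comm]
    simpa only [univ_inter] using eVariationOn.Icc_add_Icc f hb.1 hb.2 (mem_univ b)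

lemma nat_mul_le_eVariationOn_of_levels [PseudoEMetricSpace E] {γ : ℝ → E} {f : ℝ → ℝ} {x : ℕ → ℝ}
    {a b : ℝ} {r : ENNReal} {m : ℕ} (hf : ContinuousOn f (uIcc a b)) (hx : Monotone x)
    (hstep : ∀ i, ∀ s ∈ uIcc a b, ∀ t ∈ uIcc a b,
      f s = x i → f t = x (i + 1) → r ≤ edist (γ s) (γ t))
    (ha : f a ≤ x 0) (hb : x m ≤ f b) :
    m * r ≤ eVariationOn γ (uIcc a b) := by
  have exists_level : ∀ i, ∀ t ∈ uIcc a b, x i ≤ f t → ∃ u ∈ uIcc a t, f u = x i := fun i t ht hi =>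
    intermediate_value_uIcc (hf.mono (uIcc_subset_uIcc_left ht))
      (Icc_subset_uIcc ⟨ha.trans (hx i.zero_le), hi⟩)
  have reach_level : ∀ i : ℕ, ∀ t ∈ uIcc a b, f t = x i → i * r ≤ eVariationOn γ (uIcc a t) := by
    intro i
    induction i with
    | zero => simp
    | succ i ih =>
      intro t ht hti
      obtain ⟨u, hu, hui⟩ := exists_level i t ht (hti ▸ hx i.le_succ)
      have hub : u ∈ uIcc a b := uIcc_subset_uIcc_left ht hu
      calc ((i + 1 : ℕ) : ENNReal) * r = i * r + r := by push_cast; ring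
        _ ≤ eVariationOn γ (uIcc a u) + eVariationOn γ (uIcc u t) :=
          add_le_add (ih u hub hui) ((hstep i u hub t ht hui hti).trans
            (eVariationOn.edist_le γ left_mem_uIcc right_mem_uIcc))
        _ = eVariationOn γ (uIcc a t) := eVariationOn_uIcc_add_uIcc γ hu
  obtain ⟨t, ht, htm⟩ := exists_level m b right_mem_uIcc hb
  exact (reach_level m t ht htm).trans (eVariationOn.mono γ (uIcc_subset_uIcc_left ht))

/- Cut whenever the length travelled so far passes a multiple of `r`. -/
lemma exists_partition_dist_lt [PseudoMetricSpace E] {f : α → E} {a b : α}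
    (hf : BoundedVariationOn f (Icc a b)) {r : ℝ} (hr : 0 < r) :
    ∃ P : Fin (⌊(eVariationOn f (Icc a b)).toReal / r⌋₊ + 1) → Set α, ⋃ i, P i = Icc a b ∧
      ∀ i, (P i).OrdConnected ∧ ∀ x ∈ P i, ∀ y ∈ P i, dist (f x) (f y) < r := by
  set v : α → ℝ := fun t => (eVariationOn f (Icc a t)).toReal
  have bounded_of_subset {s : Set α} (hs : s ⊆ Icc a b) : eVariationOn f s ≠ ⊤ :=
    hf.mono hs
  have v_mono {x y : α} (hy : y ≤ b) (hxy : x ≤ y) : v x ≤ v y :=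
    ENNReal.toReal_mono (bounded_of_subset (Icc_subset_Icc_right hy))
      (eVariationOn.mono f (Icc_subset_Icc_right hxy))
  have dist_le_sub {x y : α} (hx : a ≤ x) (hxy : x ≤ y) (hy : y ≤ b) :
      dist (f x) (f y) ≤ v y - v x := by
    have hadd := eVariationOn.Icc_add_Icc f hx hxy (mem_univ x)
    simp only [univ_inter] at hadd
    have hxy' := bounded_of_subset (Icc_subset_Icc hx hy)
    have hv : v y = v x + (eVariationOn f (Icc x y)).toReal := by
      rw [← ENNReal.toReal_add (bounded_of_subset (Icc_subset_Icc_right (hxy.trans hy))) hxy', hadd]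
    have := BoundedVariationOn.dist_le hxy' (left_mem_Icc.2 hxy) (right_mem_Icc.2 hxy)
    linarith
  have dist_lt_of_le {x y : α} (hx : a ≤ x) (hxy : x ≤ y) (hy : y ≤ b)
      (h : ⌊v x / r⌋₊ = ⌊v y / r⌋₊) : dist (f x) (f y) < r := by
    have hfloor : v y / r < v x / r + 1 :=
      (Nat.lt_floor_add_one _).trans_le
        (by rw [← h]; gcongr; exact Nat.floor_le (div_nonneg ENNReal.toReal_nonneg hr.le))
    rw [div_add_one hr.ne', div_lt_div_iff_of_pos_right hr] at hfloor
    linarith [dist_le_sub hx hxy hy]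
  refine ⟨fun i => {t ∈ Icc a b | ⌊v t / r⌋₊ = i}, ?_, fun i => ⟨⟨?_⟩, ?_⟩⟩
  · ext t
    simp only [mem_iUnion, mem_ofPred_eq, exists_and_left, and_iff_left_iff_imp]
    intro ht
    have hle : ⌊v t / r⌋₊ ≤ ⌊v b / r⌋₊ := by gcongr; exact v_mono le_rfl ht.2
    exact ⟨⟨_, Nat.lt_succ_of_le hle⟩, rfl⟩
  · rintro x ⟨hx, hxi⟩ y ⟨hy, hyi⟩ z hz
    have hzb : z ≤ b := hz.2.trans hy.2
    refine ⟨⟨hx.1.trans hz.1, hzb⟩, le_antisymm ?_ ?_⟩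
    · rw [← hyi]; gcongr; exact v_mono hy.2 hz.2
    · rw [← hxi]; gcongr; exact v_mono hzb hz.1
  · rintro x ⟨hx, hxi⟩ y ⟨hy, hyi⟩
    rcases le_total x y with hxy | hyx
    · exact dist_lt_of_le hx.1 hxy hy.2 (hxi.trans hyi.symm)
    · rw [dist_comm]
      exact dist_lt_of_le hy.1 hyx hx.2 (hyi.trans hxi.symm)

lemma eVariationOn_extend_trans_le [PseudoEMetricSpace E] {p q r : E} (γ : Path p q)
    (δ : Path q r) :
    eVariationOn (γ.trans δ).extend (Icc 0 1) ≤
      eVariationOn γ.extend (Icc 0 1) + eVariationOn δ.extend (Icc 0 1) := by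
  have hsplit := eVariationOn.Icc_add_Icc (γ.trans δ).extend (s := univ)
    (show (0 : ℝ) ≤ 1 / 2 by norm_num) (show (1 / 2 : ℝ) ≤ 1 by norm_num) (mem_univ _)
  simp only [univ_inter] at hsplit
  have hfst : EqOn (γ.trans δ).extend (γ.extend ∘ fun t => 2 * t) (Icc 0 (1 / 2)) :=
    fun t ht => Path.extend_trans_of_le_half γ δ ht.2
  have hsnd : EqOn (γ.trans δ).extend (δ.extend ∘ fun t => 2 * t - 1) (Icc (1 / 2) 1) :=
    fun t ht => Path.extend_trans_of_half_le γ δ ht.1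
  rw [← hsplit, eVariationOn.congr hfst, eVariationOn.congr hsnd]
  refine add_le_add
    (eVariationOn.comp_le_of_monotoneOn _ _ (Monotone.monotoneOn ?_ _) fun t ht => ?_)
    (eVariationOn.comp_le_of_monotoneOn _ _ (Monotone.monotoneOn ?_ _) fun t ht => ?_)
  · exact fun x y hxy => by linarith
  · exact ⟨by linarith [ht.1], by linarith [ht.2]⟩
  · exact fun x y hxy => by linarith
  · exact ⟨by linarith [ht.1], by linarith [ht.2]⟩

lemma eVariationOn_extend_segment_le [SeminormedAddCommGroup E] [NormedSpace ℝ E] (p q : E) :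
    eVariationOn (Path.segment p q).extend (Icc 0 1) ≤ edist p q := by
  rw [eVariationOn.congr (Path.eqOn_extend_segment p q), ← Function.comp_id (AffineMap.lineMap p q)]
  calc eVariationOn (AffineMap.lineMap p q ∘ id) (Icc (0 : ℝ) 1)
      ≤ nndist p q * eVariationOn id (Icc (0 : ℝ) 1) :=
        ((lipschitzWith_lineMap p q).lipschitzOnWith (s := univ)).comp_eVariationOn_le
          (mapsTo_univ _ _)
    _ = edist p q := by rw [eVariationOn_id_Icc, edist_nndist]; simp

end Variation

section Plane

lemma ofReal_le_edist_of_le_abs_sub {p q : Plane} {i : Fin 2} {r : ℝ} (h : r ≤ |p i - q i|) :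
    ENNReal.ofReal r ≤ edist p q := by
  rw [edist_dist]
  exact ENNReal.ofReal_le_ofReal (h.trans (PiLp.dist_apply_le p q i))

lemma apply_mem_uIcc_of_mem_segment {p q z : Plane} (hz : z ∈ segment ℝ p q) (i : Fin 2) :
    z i ∈ uIcc (p i) (q i) := by
  rw [← segment_eq_uIcc]
  obtain ⟨a, b, ha, hb, hab, rfl⟩ := hz
  exact ⟨a, b, ha, hb, hab, rfl⟩

lemma edist_vertical (x y y' : ℝ) :
    edist (!₂[x, y] : Plane) !₂[x, y'] = ENNReal.ofReal |y - y'| := by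
  rw [edist_dist, EuclideanSpace.dist_eq]
  simp [Real.sqrt_sq_eq_abs, Real.dist_eq]

lemma edist_horizontal (x x' y : ℝ) :
    edist (!₂[x, y] : Plane) !₂[x', y] = ENNReal.ofReal |x - x'| := by
  rw [edist_dist, EuclideanSpace.dist_eq]
  simp [Real.sqrt_sq_eq_abs, Real.dist_eq]

lemma start_eq : start = !₂[0, 0] := by
  ext i
  fin_cases i <;> simp [start]

end Plane

section Bricks

/-- The height of the lower side of the `j`-th brick in column `i`: odd columns are shifted down by
half a brick. -/
noncomputable def level (h : ℝ) (i j : ℤ) : ℝ := h * (j - ((i % 2 : ℤ) : ℝ) / 2)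

/-- The brick of width `1` and height `h` in column `c.1` and row `c.2`. -/
noncomputable def brick (h : ℝ) (hh : 1 ≤ h) (c : ℤ × ℤ) : Obstacle where
  left := c.1
  right := c.1 + 1
  bottom := level h c.1 c.2
  top := level h c.1 c.2 + h
  one_le_width := le_rfl
  one_le_height := by gcongr

variable {h : ℝ} {hh : 1 ≤ h} {p q : Plane}

lemma mem_brick_inner {c : ℤ × ℤ} :
    p ∈ (brick h hh c).inner ↔
      (c.1 : ℝ) < p 0 ∧ p 0 < c.1 + 1 ∧ level h c.1 c.2 < p 1 ∧ p 1 < level h c.1 c.2 + h := by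
  simp [Obstacle.inner, brick]

lemma mem_brick_body {c : ℤ × ℤ} :
    p ∈ (brick h hh c).body ↔
      (c.1 : ℝ) ≤ p 0 ∧ p 0 ≤ c.1 + 1 ∧ level h c.1 c.2 ≤ p 1 ∧ p 1 ≤ level h c.1 c.2 + h := by
  simp [Obstacle.body, brick]

lemma level_sub_level (h : ℝ) (i j j' : ℤ) :
    level h i j - level h i j' = h * (j - j') := by
  unfold level; ring

lemma eq_of_level_lt_add (hh : 0 < h) {i j j' : ℤ} (hj : level h i j < level h i j' + h)
    (hj' : level h i j' < level h i j + h) : j = j' := by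
  have hlt : ((j - j' : ℤ) : ℝ) < 1 := by
    rw [← mul_lt_mul_iff_right₀ hh]; push_cast; linarith [level_sub_level h i j j']
  have hlt' : ((j' - j : ℤ) : ℝ) < 1 := by
    rw [← mul_lt_mul_iff_right₀ hh]; push_cast; linarith [level_sub_level h i j' j]
  norm_cast at hlt hlt'
  lia

lemma le_of_cast_lt_add_one {i j : ℤ} (hij : (i : ℝ) < j + 1) : i ≤ j := by
  norm_cast at hij
  exact Int.lt_add_one_iff.1 hij

lemma eq_of_mem_brick_inner {c d : ℤ × ℤ} (hc : p ∈ (brick h hh c).inner)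
    (hd : p ∈ (brick h hh d).inner) : c = d := by
  obtain ⟨hi, hi', hj, hj'⟩ := mem_brick_inner.1 hc
  obtain ⟨gi, gi', gj, gj'⟩ := mem_brick_inner.1 hd
  have hcol : c.1 = d.1 :=
    le_antisymm (le_of_cast_lt_add_one (hi.trans gi')) (le_of_cast_lt_add_one (gi.trans hi'))
  rw [hcol] at hj hj'
  exact Prod.ext hcol
    (eq_of_level_lt_add (zero_lt_one.trans_le hh) (hj.trans gj') (gj.trans hj'))

/-- The scene consisting of the bricks with indices in `F`; for `F = univ` it is the full brick
wall. -/
noncomputable def brickScene (h : ℝ) (hh : 1 ≤ h) (F : Set (ℤ × ℤ)) : Scene where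
  obstacles := brick h hh '' F
  nonoverlapping := by
    rintro _ ⟨c, -, rfl⟩ _ ⟨d, -, rfl⟩ hne
    exact disjoint_left.2 fun p hc hd => hne (by rw [eq_of_mem_brick_inner hc hd])
  start_free := by
    rintro _ ⟨c, -, rfl⟩ hs
    obtain ⟨hlt, hlt', -, -⟩ := mem_brick_inner.1 hs
    simp only [start, PiLp.zero_apply] at hlt hlt'
    norm_cast at hlt hlt'
    lia

lemma mem_free_brickScene {F : Set (ℤ × ℤ)} :
    p ∈ (brickScene h hh F).free ↔ ∀ c ∈ F, p ∉ (brick h hh c).inner :=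
  forall_mem_image

lemma exists_level_mem_Icc (hh : 0 < h) (i : ℤ) (y : ℝ) :
    ∃ j : ℤ, level h i j ≤ y ∧ y < level h i j + h := by
  have hy : y = h * (y / h) := by field_simp
  refine ⟨⌊y / h + ((i % 2 : ℤ) : ℝ) / 2⌋, ?_, ?_⟩
  · calc level h i _ ≤ h * (y / h) := by
          unfold level; gcongr; linarith [Int.floor_le (y / h + ((i % 2 : ℤ) : ℝ) / 2)]
      _ = y := hy.symm
  · calc y = h * (y / h) := hy
      _ < h * (⌊y / h + ((i % 2 : ℤ) : ℝ) / 2⌋ - ((i % 2 : ℤ) : ℝ) / 2 + 1) := by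
          gcongr; linarith [Int.lt_floor_add_one (y / h + ((i % 2 : ℤ) : ℝ) / 2)]
      _ = _ := by unfold level; ring

lemma exists_eq_level_of_mem_free (hp : p ∈ (brickScene h hh univ).free) {i : ℤ}
    (hi : (i : ℝ) < p 0) (hi' : p 0 < i + 1) : ∃ j : ℤ, p 1 = level h i j := by
  obtain ⟨j, hj, hj'⟩ := exists_level_mem_Icc (zero_lt_one.trans_le hh) i (p 1)
  refine ⟨j, hj.eq_of_not_lt' fun hlt => ?_⟩
  exact mem_free_brickScene.1 hp (i, j) (mem_univ _) (mem_brick_inner.2 ⟨hi, hi', hlt, hj'⟩)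

lemma half_le_abs_level_sub_level (hh : 0 ≤ h) (i j j' : ℤ) :
    h / 2 ≤ |level h i j - level h (i + 1) j'| := by
  have heq : level h i j - level h (i + 1) j' =
      h / 2 * ((2 * (j - j') - i % 2 + (i + 1) % 2 : ℤ) : ℝ) := by
    unfold level; push_cast; ring
  have hodd : (1 : ℝ) ≤ |((2 * (j - j') - i % 2 + (i + 1) % 2 : ℤ) : ℝ)| :=
    mod_cast Int.one_le_abs (by lia)
  rw [heq, abs_mul, abs_of_nonneg (by positivity : 0 ≤ h / 2)]
  exact le_mul_of_one_le_right (by positivity) hodd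

lemma half_le_abs_sub_of_adjacent_columns (hp : p ∈ (brickScene h hh univ).free)
    (hq : q ∈ (brickScene h hh univ).free) {i : ℤ} (hpi : p 0 = i + 1 / 2)
    (hqi : q 0 = i + 3 / 2) : h / 2 ≤ |p 1 - q 1| := by
  obtain ⟨j, hj⟩ := exists_eq_level_of_mem_free hp (i := i) (by linarith) (by linarith)
  obtain ⟨j', hj'⟩ := exists_eq_level_of_mem_free hq (i := i + 1) (by push_cast; linarith)
    (by push_cast; linarith)
  rw [hj, hj']
  exact half_le_abs_level_sub_level (by linarith) i j j'

end Bricks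

section FullWall

variable {h : ℝ} {hh : 1 ≤ h} {γ : ℝ → Plane}

lemma le_eVariationOn_of_trip {a b n : ℝ} (hγ : ContinuousOn γ (uIcc a b))
    (hfree : ∀ t ∈ uIcc a b, γ t ∈ (brickScene h hh univ).free) (ha : γ a 0 = 0)
    (hb : γ b 0 = n) :
    ENNReal.ofReal ((n - 3 / 2) * (h / 2)) ≤ eVariationOn γ (uIcc a b) := by
  rcases le_or_gt n (3 / 2) with hn | hn
  · rw [ENNReal.ofReal_of_nonpos (mul_nonpos_of_nonpos_of_nonneg (by linarith) (by linarith))]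
    exact zero_le
  calc ENNReal.ofReal ((n - 3 / 2) * (h / 2))
      ≤ ENNReal.ofReal (⌊n - 1 / 2⌋₊ * (h / 2)) := by
        gcongr; linarith [Nat.lt_floor_add_one (n - 1 / 2)]
    _ = ⌊n - 1 / 2⌋₊ * ENNReal.ofReal (h / 2) := by
        rw [ENNReal.ofReal_mul (by positivity), ENNReal.ofReal_natCast]
    _ ≤ eVariationOn γ (uIcc a b) :=
        nat_mul_le_eVariationOn_of_levels (f := fun t => γ t 0) (x := fun i => i + 1 / 2)
          (by fun_prop) (fun i j hij => by simpa using hij)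
          (fun i s hs t ht hsi hti => ofReal_le_edist_of_le_abs_sub (i := 1)
            (half_le_abs_sub_of_adjacent_columns (hfree s hs) (hfree t ht) (i := i)
              (by simpa using hsi) (by push_cast at hti ⊢; linarith)))
          (by norm_num [ha]) (by linarith [Nat.floor_le (show 0 ≤ n - 1 / 2 by linarith)])

lemma column_sub_le_two {T : Set ℝ} (hT : T.OrdConnected) (hγ : ContinuousOn γ T)
    (hfree : ∀ t ∈ T, γ t ∈ (brickScene h hh univ).free)
    (hclose : ∀ s ∈ T, ∀ t ∈ T, |γ s 1 - γ t 1| < h / 2) {s t : ℝ} (hs : s ∈ T) (ht : t ∈ T)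
    {c d : ℤ × ℤ} (hc : γ s ∈ (brick h hh c).body) (hd : γ t ∈ (brick h hh d).body) :
    d.1 - c.1 ≤ 2 := by
  by_contra! hlt
  have hcol : (c.1 : ℝ) + 3 ≤ d.1 := by exact_mod_cast (by lia : c.1 + 3 ≤ d.1)
  have hst : uIcc s t ⊆ T := hT.uIcc_subset hs ht
  have exists_abscissa (x : ℝ) (hx : c.1 + 1 ≤ x) (hx' : x ≤ c.1 + 3) : ∃ u ∈ T, γ u 0 = x := by
    have hcont : ContinuousOn (fun u => γ u 0) (uIcc s t) := by have := hγ.mono hst; fun_prop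
    obtain ⟨u, hu, hux⟩ := intermediate_value_uIcc hcont
      (Icc_subset_uIcc ⟨(mem_brick_body.1 hc).2.1.trans hx,
        (hx'.trans hcol).trans (mem_brick_body.1 hd).1⟩)
    exact ⟨u, hst hu, hux⟩
  obtain ⟨u, hu, hux⟩ := exists_abscissa (c.1 + 3 / 2) (by linarith) (by linarith)
  obtain ⟨v, hv, hvx⟩ := exists_abscissa (c.1 + 5 / 2) (by linarith) (by linarith)
  exact (hclose u hu v hv).not_ge (half_le_abs_sub_of_adjacent_columns (hfree u hu) (hfree v hv)
    (i := c.1 + 1) (by push_cast; linarith) (by push_cast; linarith))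

lemma row_sub_le_one {p q : Plane} (hpq : |p 1 - q 1| < h) {c d : ℤ × ℤ}
    (hc : p ∈ (brick h hh c).body) (hd : q ∈ (brick h hh d).body) (hcd : c.1 = d.1) :
    d.2 - c.2 ≤ 1 := by
  obtain ⟨-, -, -, hp⟩ := mem_brick_body.1 hc
  obtain ⟨-, -, hq, -⟩ := mem_brick_body.1 hd
  have hlt : ((d.2 - c.2 : ℤ) : ℝ) < 2 := by
    rw [← mul_lt_mul_iff_right₀ (zero_lt_one.trans_le hh)]
    push_cast
    rw [← level_sub_level h d.1, ← hcd]
    rw [← hcd] at hq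
    linarith [(abs_lt.1 hpq).1]
  norm_cast at hlt
  lia

lemma exists_subset_Icc_of_sub_le {A : Set ℤ} {d : ℕ} (hA : ∀ x ∈ A, ∀ y ∈ A, y - x ≤ d) :
    ∃ m, A ⊆ Icc m (m + d) := by
  rcases A.eq_empty_or_nonempty with rfl | ⟨x, hx⟩
  · exact ⟨0, empty_subset _⟩
  have hbdd : BddBelow A := ⟨x - d, fun y hy => by have := hA y hy x hx; lia⟩
  have hmem := Int.csInf_mem ⟨x, hx⟩ hbdd
  exact ⟨sInf A, fun y hy => ⟨csInf_le hbdd hy, by have := hA _ hmem y hy; lia⟩⟩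

lemma exists_finset_card_le_of_sub_le {A : Set (ℤ × ℤ)} {a b : ℕ}
    (hfst : ∀ c ∈ A, ∀ d ∈ A, d.1 - c.1 ≤ a)
    (hsnd : ∀ c ∈ A, ∀ d ∈ A, c.1 = d.1 → d.2 - c.2 ≤ b) :
    ∃ F : Finset (ℤ × ℤ), F.card ≤ (a + 1) * (b + 1) ∧ A ⊆ F := by
  obtain ⟨m, hm⟩ := exists_subset_Icc_of_sub_le (A := Prod.fst '' A) (d := a) (by
    rintro _ ⟨c, hc, rfl⟩ _ ⟨d, hd, rfl⟩; exact hfst c hc d hd)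
  have hrows (i : ℤ) : ∃ l, {j | (i, j) ∈ A} ⊆ Icc l (l + b) :=
    exists_subset_Icc_of_sub_le fun x hx y hy => hsnd _ hx _ hy rfl
  choose l hl using hrows
  refine ⟨(Finset.range (a + 1) ×ˢ Finset.range (b + 1)).image
    fun e => (m + e.1, l (m + e.1) + e.2), ?_, ?_⟩
  · exact Finset.card_image_le.trans (by simp)
  · rintro ⟨i, j⟩ hij
    have hi : m ≤ i ∧ i ≤ m + a := hm ⟨_, hij, rfl⟩
    have hj : l i ≤ j ∧ j ≤ l i + b := hl i hij
    obtain ⟨x, rfl⟩ := Int.le.dest hi.1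
    obtain ⟨y, rfl⟩ := Int.le.dest hj.1
    simp only [Finset.coe_image, mem_image, Finset.mem_coe, Finset.mem_product, Finset.mem_range]
    exact ⟨(x, y), by lia, rfl⟩

lemma exists_finset_forall_mem_of_touched {a b : ℝ} (hγ : ContinuousOn γ (Icc a b))
    (hfree : ∀ t ∈ Icc a b, γ t ∈ (brickScene h hh univ).free)
    (hV : eVariationOn γ (Icc a b) ≠ ⊤) :
    ∃ F : Finset (ℤ × ℤ), F.card ≤ 12 * (eVariationOn γ (Icc a b)).toReal / h + 6 ∧
      ∀ t ∈ Icc a b, ∀ c, γ t ∈ (brick h hh c).body → c ∈ F := by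
  have hpos : 0 < h := zero_lt_one.trans_le hh
  set V := (eVariationOn γ (Icc a b)).toReal
  obtain ⟨P, hPunion, hP⟩ := exists_partition_dist_lt hV (half_pos hpos)
  have hPsub (i) : P i ⊆ Icc a b := hPunion ▸ subset_iUnion P i
  have hpiece (i) : ∃ F : Finset (ℤ × ℤ), F.card ≤ (2 + 1) * (1 + 1) ∧
      {c | ∃ t ∈ P i, γ t ∈ (brick h hh c).body} ⊆ F := by
    have hclose (s) (hs : s ∈ P i) (t) (ht : t ∈ P i) : |γ s 1 - γ t 1| < h / 2 :=
      (PiLp.dist_apply_le (γ s) (γ t) 1).trans_lt ((hP i).2 s hs t ht)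
    refine exists_finset_card_le_of_sub_le ?_ ?_
    · rintro c ⟨s, hs, hc⟩ d ⟨t, ht, hd⟩
      exact column_sub_le_two (hP i).1 (hγ.mono (hPsub i)) (fun t ht => hfree t (hPsub i ht))
        hclose hs ht hc hd
    · rintro c ⟨s, hs, hc⟩ d ⟨t, ht, hd⟩ hcd
      exact row_sub_le_one ((hclose s hs t ht).trans (half_lt_self hpos)) hc hd hcd
  choose F hFcard hF using hpiece
  refine ⟨Finset.univ.biUnion F, ?_, fun t ht c hc => ?_⟩
  · calc ((Finset.univ.biUnion F).card : ℝ) ≤ ((⌊V / (h / 2)⌋₊ + 1) * 6 : ℕ) := by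
          gcongr
          exact (Finset.card_biUnion_le_card_mul _ _ _ fun i _ => hFcard i).trans (by simp [V])
      _ ≤ (V / (h / 2) + 1) * 6 := by
          push_cast; gcongr; exact Nat.floor_le (by positivity)
      _ = 12 * V / h + 6 := by field_simp; ring
  · rw [← hPunion] at ht
    obtain ⟨i, hi⟩ := mem_iUnion.1 ht
    exact Finset.mem_biUnion.2 ⟨i, Finset.mem_univ i, hF i ⟨t, hi, hc⟩⟩

end FullWall

section PathDistance

/-- The length of the shortest obstacle-free path from `p` to `q`, as an infimum; it is `⊤` if there
is no such path of finite length. -/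
noncomputable def Scene.pathDist (S : Scene) (p q : Plane) : ENNReal :=
  ⨅ (γ : Path p q) (_ : range γ ⊆ S.free), eVariationOn γ.extend (Icc 0 1)

lemma Scene.pathDist_triangle (S : Scene) (p q r : Plane) :
    S.pathDist p r ≤ S.pathDist p q + S.pathDist q r := by
  refine ENNReal.le_iInf₂_add_iInf₂ fun γ hγ δ hδ => ?_
  have hfree : range (γ.trans δ) ⊆ S.free := by
    rw [Path.trans_range]
    exact union_subset hγ hδ
  exact (iInf₂_le (γ.trans δ) hfree).trans (eVariationOn_extend_trans_le γ δ)

lemma Scene.pathDist_le_edist {S : Scene} {p q : Plane} (hpq : segment ℝ p q ⊆ S.free) :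
    S.pathDist p q ≤ edist p q :=
  (iInf₂_le (Path.segment p q) (by rwa [Path.range_segment])).trans
    (eVariationOn_extend_segment_le p q)

lemma Scene.shortest_le_pathDist (S : Scene) {q : Plane} {n : ℝ} (hn : 0 ≤ n) (hq : n ≤ q 0) :
    S.shortest n ≤ S.pathDist start q := by
  refine le_iInf₂ fun γ hγ => ?_
  obtain ⟨τ, hτ, hτn⟩ := intermediate_value_Icc zero_le_one
    (show ContinuousOn (fun t => γ.extend t 0) (Icc 0 1) by fun_prop)
    (show n ∈ _ by rw [γ.extend_zero, γ.extend_one]; exact ⟨hn, hq⟩)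
  have hmaps : MapsTo (fun t => τ * t) (Icc 0 1) (Icc 0 1) := fun t ht =>
    ⟨mul_nonneg hτ.1 ht.1, mul_le_one₀ hτ.2 ht.1 ht.2⟩
  have hpath : S.IsPathToWall n (γ.extend ∘ fun t => τ * t) :=
    { continuousOn := by fun_prop
      source := by simp
      target := by simpa [wall] using hτn
      free := fun t _ => hγ (mem_range_self _) }
  exact (iInf₂_le _ hpath).trans (eVariationOn.comp_le_of_monotoneOn _ _
    (fun x _ y _ hxy => mul_le_mul_of_nonneg_left hxy hτ.1) hmaps)

end PathDistance

section Detours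

variable {h : ℝ} {hh : 1 ≤ h} {F : Set (ℤ × ℤ)}

lemma pathDist_vertical_le (i : ℤ) (y y' : ℝ) :
    (brickScene h hh F).pathDist !₂[(i : ℝ), y] !₂[(i : ℝ), y'] ≤ ENNReal.ofReal |y - y'| := by
  rw [← edist_vertical i]
  refine Scene.pathDist_le_edist fun z hz => mem_free_brickScene.2 fun c _ hc => ?_
  have hz0 : z 0 = i := by simpa using apply_mem_uIcc_of_mem_segment hz 0
  obtain ⟨hlt, hlt', -, -⟩ := mem_brick_inner.1 hc
  rw [hz0] at hlt hlt'
  exact (Int.cast_lt.1 hlt).not_ge (le_of_cast_lt_add_one hlt')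

lemma pathDist_horizontal_le (i : ℤ) (y : ℝ)
    (hy : ∀ j, (i, j) ∈ F → ¬ (level h i j < y ∧ y < level h i j + h)) :
    (brickScene h hh F).pathDist !₂[(i : ℝ), y] !₂[(i : ℝ) + 1, y] ≤ 1 := by
  have hdist : edist (!₂[(i : ℝ), y] : Plane) !₂[(i : ℝ) + 1, y] = 1 := by
    simp [edist_horizontal]
  rw [← hdist]
  refine Scene.pathDist_le_edist fun z hz => mem_free_brickScene.2 fun c hcF hc => ?_
  have hz0 : z 0 ∈ Icc (i : ℝ) (i + 1) := by simpa using apply_mem_uIcc_of_mem_segment hz 0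
  have hz1 : z 1 = y := by simpa using apply_mem_uIcc_of_mem_segment hz 1
  obtain ⟨hlt, hlt', hc1⟩ := mem_brick_inner.1 hc
  obtain rfl : c.1 = i := le_antisymm (le_of_cast_lt_add_one (hlt.trans_le hz0.2))
    (le_of_cast_lt_add_one (hz0.1.trans_lt hlt'))
  rw [hz1] at hc1
  exact hy c.2 hcF hc1

/-- The height of the horizontal line crossing the bricks of row `j` at a quarter of their height in
even columns, and at three quarters of their height in odd columns. -/
noncomputable def line (h : ℝ) (j : ℤ) : ℝ := h * (j + 1 / 4)

lemma level_lt_line (hh : 0 < h) (i j : ℤ) : level h i j < line h j := by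
  have hmod : (0 : ℝ) ≤ (i % 2 : ℤ) := by exact_mod_cast Int.emod_nonneg i two_ne_zero
  unfold level line
  gcongr
  linarith

lemma line_lt_level_add (hh : 0 < h) (i j : ℤ) : line h j < level h i j + h := by
  have hmod : ((i % 2 : ℤ) : ℝ) ≤ 1 := by
    exact_mod_cast Int.lt_add_one_iff.1 (Int.emod_lt_of_pos i two_pos)
  unfold level line
  nlinarith

lemma exists_abs_line_sub_level_eq (hh : 0 ≤ h) (i j : ℤ) :
    ∃ r : ℤ, |line h j - level h i r| = h / 4 := by
  unfold level line
  rcases Int.emod_two_eq_zero_or_one i with hi | hi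
  · exact ⟨j, by rw [hi, abs_of_nonneg] <;> push_cast <;> linarith⟩
  · exact ⟨j + 1, by rw [hi, abs_of_nonpos] <;> push_cast <;> linarith⟩

lemma pathDist_detour_le (i j : ℤ) :
    (brickScene h hh F).pathDist !₂[(i : ℝ), line h j] !₂[(i : ℝ) + 1, line h j] ≤
      1 + ENNReal.ofReal (h / 2) := by
  have hpos : 0 < h := zero_lt_one.trans_le hh
  set S := brickScene h hh F
  obtain ⟨r, hr⟩ := exists_abs_line_sub_level_eq hpos.le i j
  have hup := pathDist_vertical_le (hh := hh) (F := F) i (line h j) (level h i r)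
  have hacross := pathDist_horizontal_le (hh := hh) (F := F) i (level h i r) fun l _ hl => by
    rw [eq_of_level_lt_add hpos (hl.1.trans (by linarith)) hl.2] at hl
    exact hl.1.false
  have hdown := pathDist_vertical_le (hh := hh) (F := F) (i + 1) (level h i r) (line h j)
  rw [hr] at hup
  rw [abs_sub_comm, hr] at hdown
  push_cast at hdown
  calc S.pathDist !₂[(i : ℝ), line h j] !₂[(i : ℝ) + 1, line h j]
      ≤ ENNReal.ofReal (h / 4) + 1 + ENNReal.ofReal (h / 4) :=
        (S.pathDist_triangle _ _ _).trans
          (add_le_add ((S.pathDist_triangle _ _ _).trans (add_le_add hup hacross)) hdown)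
    _ = 1 + ENNReal.ofReal (h / 2) := by
        rw [add_comm (ENNReal.ofReal _), add_assoc, ← ENNReal.ofReal_add] <;>
          first | positivity | (congr 2; ring)

lemma pathDist_along_line_le [DecidablePred (· ∈ F)] (j : ℤ) (m : ℕ) :
    (brickScene h hh F).pathDist !₂[0, line h j] !₂[(m : ℝ), line h j] ≤
      m + Nat.count (fun i : ℕ => ((i : ℤ), j) ∈ F) m * ENNReal.ofReal (h / 2) := by
  have hpos : 0 < h := zero_lt_one.trans_le hh
  induction m with
  | zero => simpa using pathDist_vertical_le (hh := hh) (F := F) 0 (line h j) (line h j)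
  | succ m ih =>
    have hstep : (brickScene h hh F).pathDist !₂[(m : ℝ), line h j] !₂[(m : ℝ) + 1, line h j] ≤
        1 + (if ((m : ℤ), j) ∈ F then 1 else 0 : ℕ) * ENNReal.ofReal (h / 2) := by
      split_ifs with hm
      · simpa using pathDist_detour_le (hh := hh) (F := F) m j
      · simpa using pathDist_horizontal_le (hh := hh) (F := F) m (line h j) fun l hl hlt => hm <| by
          rwa [eq_of_level_lt_add hpos ((level_lt_line hpos m j).trans hlt.2)
            (hlt.1.trans (line_lt_level_add hpos m j))]
    calc _ ≤ _ := Scene.pathDist_triangle _ _ !₂[(m : ℝ), line h j] _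
      _ ≤ _ := add_le_add ih (by simpa using hstep)
      _ = _ := by rw [Nat.count_succ]; split_ifs <;> push_cast <;> ring

lemma shortest_brickScene_le_of_line [DecidablePred (· ∈ F)] (j : ℤ) {n : ℝ} (hn : 0 ≤ n) :
    (brickScene h hh F).shortest n ≤ ENNReal.ofReal (|line h j| + (n + 1 +
      Nat.count (fun i : ℕ => ((i : ℤ), j) ∈ F) (⌊n⌋₊ + 1) * (h / 2))) := by
  have : 0 ≤ h := zero_le_one.trans hh
  set S := brickScene h hh F
  set m := ⌊n⌋₊ + 1
  set N := Nat.count (fun i : ℕ => ((i : ℤ), j) ∈ F) m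
  have hup : S.pathDist start !₂[0, line h j] ≤ ENNReal.ofReal |line h j| := by
    simpa [start_eq] using pathDist_vertical_le (hh := hh) (F := F) 0 0 (line h j)
  have hm : (m : ℝ) ≤ n + 1 := by
    simpa [m] using Nat.floor_le hn
  calc S.shortest n ≤ S.pathDist start !₂[(m : ℝ), line h j] :=
        S.shortest_le_pathDist hn (by simpa [m] using (Nat.lt_floor_add_one n).le)
    _ ≤ ENNReal.ofReal |line h j| + (m + N * ENNReal.ofReal (h / 2)) :=
        (S.pathDist_triangle _ _ _).trans (add_le_add hup (pathDist_along_line_le j m))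
    _ = ENNReal.ofReal (|line h j| + (m + N * (h / 2))) := by
        rw [ENNReal.ofReal_add, ENNReal.ofReal_add, ENNReal.ofReal_mul, ENNReal.ofReal_natCast,
          ENNReal.ofReal_natCast] <;> positivity
    _ ≤ ENNReal.ofReal (|line h j| + (n + 1 + N * (h / 2))) := by gcongr

lemma abs_line_le (hh : 0 ≤ h) {j J : ℤ} (hj : -J ≤ j) (hj' : j < J) : |line h j| ≤ h * J := by
  have hlow : (-J : ℝ) ≤ j := by exact_mod_cast hj
  have hupp : (j : ℝ) + 1 ≤ J := by exact_mod_cast hj'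
  rw [line, abs_mul, abs_of_nonneg hh]
  gcongr
  exact abs_le.2 ⟨by linarith, by linarith⟩

lemma count_le_card_filter (F : Finset (ℤ × ℤ)) (j : ℤ) (m : ℕ) :
    Nat.count (fun i : ℕ => ((i : ℤ), j) ∈ (F : Set (ℤ × ℤ))) m ≤ {c ∈ F | c.2 = j}.card := by
  rw [Nat.count_eq_card_filter_range]
  exact Finset.card_le_card_of_injOn (fun i => ((i : ℤ), j)) (fun i hi => by simpa using
    (Finset.mem_filter.1 hi).2) fun i _ i' _ => by simp

lemma shortest_brickScene_le (F : Finset (ℤ × ℤ)) {n : ℝ} (hn : 0 ≤ n) {J : ℕ} (hJ : 0 < J) :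
    (brickScene h hh F).shortest n ≤
      ENNReal.ofReal (h * J + F.card * h / (4 * J) + n + 1) := by
  have hpos : 0 < h := zero_lt_one.trans_le hh
  obtain ⟨j, hj, hcard⟩ := Finset.exists_card_fiber_le_of_card_le_nsmul
    (s := F) (t := Finset.Ico (-J : ℤ) J) (f := Prod.snd) (b := (F.card / (2 * J) : ℝ))
    (by simpa using hJ) (by
      rw [Int.card_Ico, show ((J : ℤ) - -J).toNat = 2 * J by lia, nsmul_eq_mul]
      push_cast; field_simp; rfl)
  have hJ' : (0 : ℝ) < J := by exact_mod_cast hJ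
  rw [Finset.mem_Ico] at hj
  refine (shortest_brickScene_le_of_line j hn).trans (ENNReal.ofReal_le_ofReal ?_)
  calc _ ≤ h * J + (n + 1 + F.card / (2 * J) * (h / 2)) := by
        gcongr
        · exact_mod_cast abs_line_le hpos.le hj.1 hj.2
        · exact (Nat.cast_le.2 (count_le_card_filter F j _)).trans hcard
    _ = h * J + F.card * h / (4 * J) + n + 1 := by field_simp; ring

end Detours

lemma sixth_mul_sqrt_mul_le {n k V J : ℝ} (hk : 1 ≤ k) (hn : 36 * k ≤ n)
    (hV : k * ((n - 3 / 2) * (n / 2)) ≤ V) (hJ : √(3 * V / n) ≤ J) (hJ' : J ≤ √(3 * V / n) + 1) :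
    1 / 6 * √(n / k) * (k * (n * J + (3 * V + 3 / 2 * n) / J + n + 1)) ≤ V := by
  have hn0 : 0 < n := by linarith
  have hV0 : 0 ≤ V := hV.trans' (mul_nonneg (by linarith) (mul_nonneg (by linarith) (by linarith)))
  set s := √(3 * V / n)
  have hsV : V = n * s ^ 2 / 3 := by
    rw [Real.sq_sqrt (by positivity)]; field_simp
  have hks : 23 / 16 * (n * k) ≤ s ^ 2 := by
    have : k * ((n - 3 / 2) / 2) ≤ s ^ 2 / 3 := by
      refine le_of_mul_le_mul_left ?_ hn0
      linarith
    nlinarith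
  have hs : 7 ≤ s := by
    refine le_of_sq_le_sq ?_ (Real.sqrt_nonneg _)
    nlinarith
  set w := √(n / k) * k with hw
  have hws : w ≤ 21 / 25 * s := by
    have hnk : 0 < n * k := by positivity
    refine le_of_sq_le_sq ?_ (by positivity)
    calc w ^ 2 = n * k := by rw [hw, mul_pow, Real.sq_sqrt (by positivity)]; field_simp
      _ ≤ (21 / 25 * s) ^ 2 := by linarith
  have hquot : (3 * V + 3 / 2 * n) / J ≤ n * (s + 1 / 4) := by
    rw [div_le_iff₀ (by linarith), hsV]
    calc 3 * (n * s ^ 2 / 3) + 3 / 2 * n = n * (s ^ 2 + 3 / 2) := by ring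
      _ ≤ n * ((s + 1 / 4) * J) := by gcongr; nlinarith
      _ = n * (s + 1 / 4) * J := by ring
  have hlength : n * J + (3 * V + 3 / 2 * n) / J + n + 1 ≤ n * (2 * s + 5 / 2) := by
    linarith [mul_le_mul_of_nonneg_left hJ' hn0.le]
  calc 1 / 6 * √(n / k) * (k * (n * J + (3 * V + 3 / 2 * n) / J + n + 1))
      = 1 / 6 * (w * (n * J + (3 * V + 3 / 2 * n) / J + n + 1)) := by rw [hw]; ring
    _ ≤ 1 / 6 * (w * (n * (2 * s + 5 / 2))) := by gcongr
    _ ≤ 1 / 6 * (21 / 25 * s * (n * (2 * s + 5 / 2))) := by gcongr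
    _ = n * s ^ 2 / 3 - n * s * (4 / 75 * s - 7 / 20) := by ring
    _ ≤ n * s ^ 2 / 3 := sub_le_self _ (mul_nonneg (by positivity) (by linarith))
    _ = V := hsV.symm

namespace Strategy

variable {n : ℝ} {k : ℕ}

lemma totalDist_eq_eVariationOn (R : Strategy n k) (S : Scene) :
    R.totalDist S = eVariationOn (R.path S) (Icc 0 k) := by
  have hsum := eVariationOn.sum' (R.path S) (I := fun i : ℕ => (i : ℝ)) Nat.mono_cast (n := k)
  rw [Nat.cast_zero] at hsum
  rw [← hsum, totalDist, ← Finset.Ico_add_one_right_eq_Icc, Finset.sum_Ico_eq_sum_range,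
    Nat.add_sub_cancel]
  exact Finset.sum_congr rfl fun i _ => by simp [tripDist, add_comm 1 i]

lemma trip_subset {i : ℕ} (hi : i < k) : Icc (i : ℝ) (i + 1) ⊆ Icc 0 k :=
  Icc_subset_Icc (Nat.cast_nonneg i) (by exact_mod_cast hi)

lemma coord_trip_endpoints (R : Strategy n k) (S : Scene) {i : ℕ} (hi : i < k) :
    (R.path S i 0 = 0 ∧ R.path S (i + 1) 0 = n) ∨ (R.path S i 0 = n ∧ R.path S (i + 1) 0 = 0) := by
  have hsource := R.goal_mem S i hi.le
  have htarget := R.goal_mem S (i + 1) hi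
  push_cast at htarget
  by_cases heven : Even i
  · rw [goal, if_pos heven, mem_singleton_iff] at hsource
    rw [goal, if_neg (by simpa [Nat.even_add_one] using heven)] at htarget
    exact Or.inl ⟨by simp [hsource, start], htarget⟩
  · rw [goal, if_neg heven] at hsource
    rw [goal, if_pos (by simpa [Nat.even_add_one] using heven), mem_singleton_iff] at htarget
    exact Or.inr ⟨hsource, by simp [htarget, start]⟩

lemma mul_le_totalDist (R : Strategy n k) (S : Scene) {r : ENNReal}
    (hr : ∀ i < k, r ≤ eVariationOn (R.path S) (Icc i (i + 1))) : k * r ≤ R.totalDist S := by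
  have hcard : (Finset.Icc 1 k).card • r ≤ R.totalDist S := by
    refine Finset.card_nsmul_le_sum _ _ _ fun i hi => ?_
    rw [Finset.mem_Icc] at hi
    obtain ⟨i, rfl⟩ := Nat.exists_eq_add_of_le' hi.1
    simpa [tripDist] using hr i (by lia)
  simpa using hcard

lemma ofReal_mul_le_totalDist (R : Strategy n k) (S : Scene) :
    ENNReal.ofReal (k * n) ≤ R.totalDist S := by
  rw [ENNReal.ofReal_mul k.cast_nonneg, ENNReal.ofReal_natCast]
  refine R.mul_le_totalDist S fun i hi => ?_
  refine le_trans (ofReal_le_edist_of_le_abs_sub (i := 0) ?_) (eVariationOn.edist_le (R.path S)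
    (left_mem_Icc.2 (by linarith)) (right_mem_Icc.2 (by linarith)))
  rcases R.coord_trip_endpoints S hi with ⟨hsource, htarget⟩ | ⟨hsource, htarget⟩ <;>
    rw [hsource, htarget] <;> simp [le_abs_self]

lemma ofReal_mul_le_totalDist_wall (R : Strategy n k) {h : ℝ} {hh : 1 ≤ h} :
    ENNReal.ofReal (k * ((n - 3 / 2) * (h / 2))) ≤ R.totalDist (brickScene h hh univ) := by
  set W := brickScene h hh univ
  rw [ENNReal.ofReal_mul k.cast_nonneg, ENNReal.ofReal_natCast]
  refine R.mul_le_totalDist W fun i hi => ?_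
  have hγ := (R.continuousOn W).mono (trip_subset hi)
  have hfree (t) (ht : t ∈ Icc (i : ℝ) (i + 1)) := R.free W t (trip_subset hi ht)
  have hle : (i : ℝ) ≤ i + 1 := by linarith
  rcases R.coord_trip_endpoints W hi with ⟨hsource, htarget⟩ | ⟨hsource, htarget⟩
  · rw [← uIcc_of_le hle] at hγ hfree ⊢
    exact le_eVariationOn_of_trip hγ hfree hsource htarget
  · rw [← uIcc_of_ge hle] at hγ hfree ⊢
    exact le_eVariationOn_of_trip hγ hfree htarget hsource

lemma eqOn_path_of_touched_subset (R : Strategy n k) {S S' : Scene}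
    (hsub : S'.obstacles ⊆ S.obstacles)
    (htouched : ∀ t ∈ Icc (0 : ℝ) k, S.touched (R.path S t) ⊆ S'.obstacles) :
    EqOn (R.path S') (R.path S) (Icc 0 k) := by
  refine fun T hT => R.online S S' T hT fun t ht => Subset.antisymm (fun O hO => ?_) fun O hO => ?_
  · exact ⟨htouched t ⟨ht.1, ht.2.trans hT.2⟩ hO, hO.2⟩
  · exact ⟨hsub hO.1, hO.2⟩

lemma exists_totalDist_eq_and_shortest_le (R : Strategy n k) {h : ℝ} {hh : 1 ≤ h} (hn : 0 ≤ n)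
    (hV : R.totalDist (brickScene h hh univ) ≠ ⊤) {J : ℕ} (hJ : 0 < J) :
    ∃ S : Scene, R.totalDist S = R.totalDist (brickScene h hh univ) ∧
      S.shortest n ≤ ENNReal.ofReal
        (h * J + (3 * (R.totalDist (brickScene h hh univ)).toReal + 3 / 2 * h) / J + n + 1) := by
  have : 0 < h := zero_lt_one.trans_le hh
  set W := brickScene h hh univ
  set V := (R.totalDist W).toReal with hV_def
  rw [totalDist_eq_eVariationOn] at hV hV_def
  obtain ⟨F, hFcard, hF⟩ := exists_finset_forall_mem_of_touched (R.continuousOn W) (R.free W) hV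
  rw [← hV_def] at hFcard
  have hEq : EqOn (R.path (brickScene h hh F)) (R.path W) (Icc 0 k) := by
    refine R.eqOn_path_of_touched_subset (image_mono (subset_univ _)) ?_
    rintro t ht _ ⟨⟨c, -, rfl⟩, hc⟩
    exact mem_image_of_mem _ (hF t ht c hc)
  refine ⟨brickScene h hh F, ?_, (shortest_brickScene_le F hn hJ).trans ?_⟩
  · rw [totalDist_eq_eVariationOn, totalDist_eq_eVariationOn, eVariationOn.congr hEq]
  · gcongr ENNReal.ofReal (_ + ?_ + _ + _)
    calc F.card * h / (4 * J) ≤ (12 * V / h + 6) * h / (4 * J) := by gcongr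
      _ = (3 * V + 3 / 2 * h) / J := by field_simp; ring

lemma ofReal_le_cumulativeRatio (R : Strategy n k) {S : Scene} {c ℓ D : ℝ} (hc : 0 ≤ c) (hD : 0 < D)
    (hℓ : S.shortest n ≤ ENNReal.ofReal ℓ) (hDS : ENNReal.ofReal D ≤ R.totalDist S)
    (hcD : c * (k * ℓ) ≤ D) : ENNReal.ofReal c ≤ R.cumulativeRatio := by
  have hfin : k * S.shortest n ≠ ⊤ :=
    ENNReal.mul_ne_top (ENNReal.natCast_ne_top k) (ne_top_of_le_ne_top ENNReal.ofReal_ne_top hℓ)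
  have hpos : R.totalDist S ≠ 0 := ((ENNReal.ofReal_pos.2 hD).trans_le hDS).ne'
  refine le_iSup_of_le S ((ENNReal.le_div_iff_mul_le (Or.inr hpos) (Or.inl hfin)).2 ?_)
  calc ENNReal.ofReal c * (k * S.shortest n)
      ≤ ENNReal.ofReal c * (k * ENNReal.ofReal ℓ) := by gcongr
    _ = ENNReal.ofReal (c * (k * ℓ)) := by
        rw [ENNReal.ofReal_mul hc, ENNReal.ofReal_mul k.cast_nonneg, ENNReal.ofReal_natCast]
    _ ≤ R.totalDist S := (ENNReal.ofReal_le_ofReal hcD).trans hDS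

lemma one_le_cumulativeRatio (R : Strategy n k) (hk : 1 ≤ k) (hn : 0 < n) :
    1 ≤ R.cumulativeRatio := by
  have hk0 : (0 : ℝ) < k := by exact_mod_cast hk
  set S := brickScene 1 le_rfl ∅
  have hsegment : segment ℝ start !₂[n, 0] ⊆ S.free := fun _ _ =>
    mem_free_brickScene.2 fun c hc => hc.elim
  have hshort : S.shortest n ≤ ENNReal.ofReal n :=
    calc S.shortest n ≤ S.pathDist start !₂[n, 0] := S.shortest_le_pathDist hn.le (by simp)
      _ ≤ edist start !₂[n, 0] := Scene.pathDist_le_edist hsegment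
      _ = ENNReal.ofReal n := by rw [start_eq, edist_horizontal]; simp [abs_of_pos hn]
  rw [← ENNReal.ofReal_one]
  exact R.ofReal_le_cumulativeRatio zero_le_one (mul_pos hk0 hn) hshort
    (R.ofReal_mul_le_totalDist S) (one_mul _).le

lemma ofReal_le_cumulativeRatio_of_totalDist_eq_top (R : Strategy n k) {S : Scene}
    (hS : R.totalDist S = ⊤) {ℓ : ℝ} (hℓ : S.shortest n ≤ ENNReal.ofReal ℓ) {c : ℝ} (hc : 0 ≤ c) :
    ENNReal.ofReal c ≤ R.cumulativeRatio :=
  R.ofReal_le_cumulativeRatio hc (lt_max_of_lt_left one_pos) hℓ (hS ▸ le_top)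
    (le_max_right 1 (c * (k * ℓ)))

lemma ofReal_le_cumulativeRatio_of_le (R : Strategy n k) (hk : 1 ≤ k) (hn : 36 * (k : ℝ) ≤ n) :
    ENNReal.ofReal (1 / 6 * √(n / k)) ≤ R.cumulativeRatio := by
  have hk1 : (1 : ℝ) ≤ k := by exact_mod_cast hk
  have hn1 : 1 ≤ n := by linarith
  have hn0 : 0 ≤ n := by linarith
  set W := brickScene n hn1 univ
  have hc : 0 ≤ 1 / 6 * √(n / k) := by positivity
  by_cases htop : R.totalDist W = ⊤
  · classical
    exact R.ofReal_le_cumulativeRatio_of_totalDist_eq_top htop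
      (shortest_brickScene_le_of_line 0 hn0) hc
  set V := (R.totalDist W).toReal
  have hV : k * ((n - 3 / 2) * (n / 2)) ≤ V :=
    (ENNReal.ofReal_le_iff_le_toReal htop).1 R.ofReal_mul_le_totalDist_wall
  have hV0 : 0 < V := hV.trans_lt' <|
    mul_pos (by linarith) (mul_pos (by linarith) (by linarith))
  have hJ : 0 < ⌈√(3 * V / n)⌉₊ := Nat.ceil_pos.2 (by positivity)
  obtain ⟨S, hSdist, hSshort⟩ := R.exists_totalDist_eq_and_shortest_le hn0 htop hJ
  exact R.ofReal_le_cumulativeRatio hc hV0 hSshort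
    (by rw [hSdist, ENNReal.ofReal_toReal htop]) (sixth_mul_sqrt_mul_le hk1 hn hV (Nat.le_ceil _)
    (Nat.ceil_lt_add_one (Real.sqrt_nonneg _)).le)

end Strategy

end Navigation

theorem theorem1_general {n : ℝ} {k : ℕ} (hk : 1 ≤ k) (hn : 0 ≤ n) (R : Navigation.Strategy n k) :
    ENNReal.ofReal (1 / 6 * √(n / k)) ≤ R.cumulativeRatio := by
  have hk0 : (0 : ℝ) < k := by exact_mod_cast hk
  rcases le_total (36 * (k : ℝ)) n with hlarge | hsmall
  · exact R.ofReal_le_cumulativeRatio_of_le hk hlarge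
  rcases hn.eq_or_lt with rfl | hpos
  · simp
  have hsqrt : √(n / k) ≤ 6 := by
    rw [Real.sqrt_le_left (by norm_num), div_le_iff₀ hk0]
    linarith
  refine le_trans ?_ (R.one_le_cumulativeRatio hk hpos)
  rw [ENNReal.ofReal_le_one]
  linarith

theorem theorem1 (n : ℝ) (k : ℕ) (hk : 1 ≤ k) (hkn : (k : ℝ) ≤ n)
    (R : Navigation.Strategy n k) :
    ENNReal.ofReal (1 / 12 * Real.sqrt (n / k)) ≤ R.cumulativeRatio :=
  (ENNReal.ofReal_le_ofReal (by gcongr; norm_num)).trans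
    (theorem1_general hk (k.cast_nonneg.trans hkn) R)
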